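/- Let $S$ be a countable set (the lattice), let $E$ be a finite set with the discrete $\sigma$-algebra, and let $\Omega=E^S$ carry the product $\sigma$-algebra $\mathcal F$. For a finite $\Lambda\subset S$ let $\mathcal F_{\Lambda^c}$ be the $\sigma$-algebra generated by the coordinates $\omega_i$, $i\notin\Lambda$, and let $\mathcal F_\infty=\bigcap_{\Lambda}\mathcal F_{\Lambda^c}$ be the tail $\sigma$-algebra. A cylinder is a set $\{\omega\in\Omega:\omega_i=\sigma_i \text{ for all } i\in\Delta\}$ with $\Delta\subset S$ finite and $\sigma\in\Omega$. A specification is a family $\gamma=(\gamma_\Lambda)_{\Lambda\subset S\text{ finite}}$ of probability kernels from $(\Omega,\mathcal F)$ to itself such that $\gamma_\Lambda(A|\cdot)$ is $\mathcal F_{\Lambda^c}$-measurable for every $A\in\mathcal F$; $\gamma_\Lambda(B|\omega)=\mathbf 1_B(\omega)$ for every $B\in\mathcal F_{\Lambda^c}$ and $\omega\in\Omega$; and $\gamma_\Lambda\gamma_{\Lambda'}=\gamma_\Lambda$ whenever $\Lambda'\subset\Lambda$, where $\gamma_\Lambda\gamma_{\Lambda'}(A|\omega)=\int\gamma_{\Lambda'}(A|\omega')\,\gamma_\Lambda(d\omega'|\omega)$.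 Let $\mathcal G(\gamma)$ be the set of probability measures $\mu$ on $(\Omega,\mathcal F)$ such that, for every finite $\Lambda$ and every $A\in\mathcal F$, $\mu[A\mid\mathcal F_{\Lambda^c}]=\gamma_\Lambda(A|\cdot)$ $\mu$-almost surely. Write $\mathrm{ex}\,\mathcal G(\gamma)$ for the set of extreme points of $\mathcal G(\gamma)$, and let $e(\mathrm{ex}\,\mathcal G(\gamma))$ be the smallest $\sigma$-algebra on it that makes all maps $\nu\mapsto\nu(A)$, $A\in\mathcal F$, measurable. Assume that $\mathcal G(\gamma)\neq\emptyset$. Then $\mathcal G(\gamma)$ is convex, and the following hold. 1. $\mathrm{ex}\,\mathcal G(\gamma)=\{\mu\in\mathcal G(\gamma):\mu(B)=0\text{ or }\mu(B)=1\text{ for all }B\in\mathcal F_\infty\}$. Distinct $\mu,\nu\in\mathrm{ex}\,\mathcal G(\gamma)$ are mutually singular, and there is $B\in\mathcal F_\infty$ with $\mu(B)=1$ and $\nu(B)=0$. More generally, if $\mu,\nu\in\mathcal G(\gamma)$ coincide on $\mathcal F_\infty$, then $\mu=\nu$. 2. For every $\mu\in\mathcal G(\gamma)$ there is exactly one probability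 measure $\alpha_\mu$ on $(\mathrm{ex}\,\mathcal G(\gamma),e(\mathrm{ex}\,\mathcal G(\gamma)))$ such that $\mu(A)=\int_{\mathrm{ex}\,\mathcal G(\gamma)}\nu(A)\,\alpha_\mu(d\nu)$ for all $A\in\mathcal F$. Moreover, for every increasing sequence $(\Lambda_n)_{n\in\mathbb N}$ of finite sets with $\bigcup_n\Lambda_n=S$ and every $M\in e(\mathrm{ex}\,\mathcal G(\gamma))$, the set $\{\omega\in\Omega:\exists\,\nu\in M,\ \lim_n\gamma_{\Lambda_n}(C|\omega)=\nu(C)\text{ for every cylinder }C\}$ belongs to $\mathcal F$ and $$\alpha_\mu(M)=\mu\big(\{\omega\in\Omega:\exists\,\nu\in M,\ \lim_n\gamma_{\Lambda_n}(C|\omega)=\nu(C)\text{ for every cylinder }C\}\big).$$ -/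

import Mathlib

open MeasureTheory ProbabilityTheory Filter Topology
open scoped NNReal ENNReal

/-- The cylinder `{ω : ω_Δ = σ_Δ}` of the configuration space `S → E`, for a finite set `Δ` of
sites and a configuration `σ` (of which only the restriction to `Δ` matters). -/
def spinCylinder {S E : Type*} (Δ : Finset S) (σ : S → E) : Set (S → E) :=
  {ω | ∀ i ∈ Δ, ω i = σ i}

/-- The σ-algebra `F_{Λᶜ}` on the configuration space generated by the spins outside `Λ`. -/
abbrev outsideSigma {S E : Type*} [MeasurableSpace E] (Λ : Finset S) :
    MeasurableSpace (S → E) :=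
  cylinderEvents (X := fun _ : S => E) ((Λ : Set S)ᶜ)

/-- The tail σ-algebra `F_∞ = ⋂_Λ F_{Λᶜ}`, where `Λ` runs over the finite sets of sites. -/
abbrev tailSigma (S E : Type*) [MeasurableSpace E] : MeasurableSpace (S → E) :=
  ⨅ Λ : Finset S, outsideSigma Λ

/-- A specification: a family of probability kernels `γ_Λ(A | ω)`, written `γ Λ ω A`, indexed by
the finite sets of sites. Mathlib's composition `γ Λ' ∘ₖ γ Λ` is the kernel
`(A, ω) ↦ ∫ γ_{Λ'}(A | ω') γ_Λ(dω' | ω)`, that is, the product `γ_Λ γ_{Λ'}`. -/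
structure IsSpecification {S E : Type*} [MeasurableSpace E]
    (γ : Finset S → Kernel (S → E) (S → E)) : Prop where
  isMarkovKernel : ∀ Λ, IsMarkovKernel (γ Λ)
  measurable_outside : ∀ (Λ : Finset S) (A : Set (S → E)), MeasurableSet A →
    Measurable[outsideSigma Λ] fun ω => γ Λ ω A
  proper : ∀ (Λ : Finset S) (ω : S → E) (B : Set (S → E)), MeasurableSet[outsideSigma Λ] B →
    γ Λ ω B = B.indicator (fun _ => (1 : ℝ≥0∞)) ω
  consistent : ∀ Λ' Λ : Finset S, Λ' ⊆ Λ → γ Λ' ∘ₖ γ Λ = γ Λ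

/-- The set `G(γ)` of DLR measures for `γ`: the probability measures `μ` such that, for every
finite `Λ` and every event `A`, `γ_Λ(A | ·)` is a version of the conditional probability
`μ[A | F_{Λᶜ}]`. -/
def dlrMeasures {S E : Type*} [MeasurableSpace E]
    (γ : Finset S → Kernel (S → E) (S → E)) : Set (Measure (S → E)) :=
  {μ | IsProbabilityMeasure μ ∧ ∀ (Λ : Finset S) (A : Set (S → E)), MeasurableSet A →
    μ⟦A | outsideSigma Λ⟧ =ᵐ[μ] fun ω => (γ Λ ω).real A}

/-- The set `ex G(γ)` of extreme points of `G(γ)`. Measures carry scalar multiplication by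
nonnegative reals only, so the convex combinations have coefficients in `ℝ≥0`. As a subtype it
carries the evaluation σ-algebra, the smallest one that makes all maps `ν ↦ ν A` measurable. -/
abbrev extremeDLR {S E : Type*} [MeasurableSpace E]
    (γ : Finset S → Kernel (S → E) (S → E)) : Set (Measure (S → E)) :=
  (dlrMeasures γ).extremePoints ℝ≥0

/-- The event that, along the sequence of volumes `Λ n`, the kernels `γ_{Λ n}(· | ω)` converge on
all cylinders to some measure belonging to `M`. -/
def limitEvent {S E : Type*} [MeasurableSpace E] (γ : Finset S → Kernel (S → E) (S → E))
    (Λ : ℕ → Finset S) (M : Set (extremeDLR γ)) : Set (S → E) :=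
  {ω | ∃ ν ∈ M, ∀ (Δ : Finset S) (σ : S → E),
    Tendsto (fun n => γ (Λ n) ω (spinCylinder Δ σ)) atTop
      (𝓝 ((ν : Measure (S → E)) (spinCylinder Δ σ)))}

/-! Along volumes exhausting `S`, the kernels `γ_{Λ n}(A | ·)` are versions of conditional
probabilities given decreasing σ-algebras, so they converge almost surely under every DLR measure
(backward martingale convergence). Their upper limit `tailLimsup` is tail measurable, depends on `γ`
alone, and is a version of `μ(A | F_∞)` for all DLR measures `μ` at once. Hence the tail σ-algebra
determines a DLR measure, extreme points are the tail-trivial DLR measures, and under an extreme `ν`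
the kernels converge to `ν` itself on cylinders.

For existence, disintegrate `μ` over the tail: almost every conditional measure is an extreme DLR
measure, and `α` is the law of this random measure (`exists_representing`). For uniqueness, an
extreme `ν` gives the limit event of `M` mass `1_M(ν)`; integrating over any representing `α` yields
`α M = μ (limitEvent γ Λ M)` (`representing_apply`). -/

/-! ### Backward martingale convergence. -/

section BackwardMartingale

variable {Ω : Type*} {m0 : MeasurableSpace Ω} {μ : Measure Ω} [IsFiniteMeasure μ]

theorem integral_condExp_mul_condExp_of_le {m₁ m₂ : MeasurableSpace Ω} (h21 : m₂ ≤ m₁)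
    (h1 : m₁ ≤ m0) {f : Ω → ℝ} (hf : MemLp f 2 μ) :
    ∫ ω, (μ[f | m₁]) ω * (μ[f | m₂]) ω ∂μ = ∫ ω, (μ[f | m₂]) ω ^ 2 ∂μ := by
  have hu : MemLp (μ[f | m₁]) 2 μ := hf.condExp (by norm_num)
  have hv : MemLp (μ[f | m₂]) 2 μ := hf.condExp (by norm_num)
  have key : μ[μ[f | m₁] * μ[f | m₂] | m₂] =ᵐ[μ] μ[f | m₂] * μ[f | m₂] :=
    (condExp_mul_of_stronglyMeasurable_right stronglyMeasurable_condExp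
      (hu.integrable_mul hv) (hu.integrable (by norm_num))).trans
      ((condExp_condExp_of_le h21 h1).mul (EventuallyEq.refl _ _))
  calc ∫ ω, (μ[f | m₁]) ω * (μ[f | m₂]) ω ∂μ
      = ∫ ω, (μ[μ[f | m₁] * μ[f | m₂] | m₂]) ω ∂μ :=
        (integral_condExp (h21.trans h1)).symm
    _ = ∫ ω, (μ[f | m₂]) ω ^ 2 ∂μ := by
        refine integral_congr_ae (key.trans (ae_of_all _ fun ω => ?_))
        simp [sq]

/-- Orthogonality of martingale increments. The second moments therefore decrease along a backward
martingale, and being bounded below they control its increments. -/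
theorem integral_condExp_sub_sq_of_le {m₁ m₂ : MeasurableSpace Ω} (h21 : m₂ ≤ m₁)
    (h1 : m₁ ≤ m0) {f : Ω → ℝ} (hf : MemLp f 2 μ) :
    ∫ ω, ((μ[f | m₁]) ω - (μ[f | m₂]) ω) ^ 2 ∂μ =
      ∫ ω, (μ[f | m₁]) ω ^ 2 ∂μ - ∫ ω, (μ[f | m₂]) ω ^ 2 ∂μ := by
  have hu : MemLp (μ[f | m₁]) 2 μ := hf.condExp (by norm_num)
  have hv : MemLp (μ[f | m₂]) 2 μ := hf.condExp (by norm_num)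
  have huv : Integrable (fun ω => (μ[f | m₁]) ω * (μ[f | m₂]) ω) μ := hu.integrable_mul hv
  have e : ∀ ω, ((μ[f | m₁]) ω - (μ[f | m₂]) ω) ^ 2 =
      (μ[f | m₁]) ω ^ 2 - 2 * ((μ[f | m₁]) ω * (μ[f | m₂]) ω) + (μ[f | m₂]) ω ^ 2 :=
    fun ω => by ring
  simp_rw [e]
  have hi : Integrable (fun ω =>
      (μ[f | m₁]) ω ^ 2 - 2 * ((μ[f | m₁]) ω * (μ[f | m₂]) ω)) μ :=
    hu.integrable_sq.sub (huv.const_mul 2)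
  rw [integral_add hi hv.integrable_sq,
    integral_sub hu.integrable_sq (huv.const_mul 2), integral_const_mul,
    integral_condExp_mul_condExp_of_le h21 h1 hf]
  ring

variable {F : ℕ → MeasurableSpace Ω}

/-- The maximal inequality for a backward martingale, relative to its last term. -/
theorem backward_maximal_ineq (hF : Antitone F) (hle : ∀ n, F n ≤ m0) (f : Ω → ℝ)
    (ε : ℝ≥0) {m N : ℕ} (hmN : m ≤ N) :
    ε * μ {ω | ∃ n, m ≤ n ∧ n ≤ N ∧ (ε : ℝ) ≤ |(μ[f | F n]) ω - (μ[f | F N]) ω|} ≤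
      ENNReal.ofReal (∫ ω, |(μ[f | F m]) ω - (μ[f | F N]) ω| ∂μ) := by
  set h : Ω → ℝ := μ[f | F m] - μ[f | F N] with hh
  -- Reversing time turns the decreasing σ-algebras into a filtration; for `m ≤ n ≤ N` the
  -- conditional expectation of `h` given `F n` is the increment from `N` to `n`.
  let 𝒢 : Filtration ℕ m0 := ⟨fun k => F (N - k), fun i j hij => hF (by omega), fun k => hle _⟩
  have hM := martingale_condExp h 𝒢 μ
  have hS := hM.submartingale.sup hM.neg.submartingale
  have hval : ∀ k ω, ((fun i => μ[h | 𝒢 i]) ⊔ -fun i => μ[h | 𝒢 i]) k ω = |(μ[h | 𝒢 k]) ω| :=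
    fun k ω => rfl
  have hmax := maximal_ineq hS (fun k ω => by rw [hval]; exact abs_nonneg _) (ε := ε) (N - m)
  simp_rw [hval] at hmax
  have hcond : ∀ n, m ≤ n → n ≤ N → μ[h | F n] =ᵐ[μ] μ[f | F n] - μ[f | F N] := by
    intro n h1 h2
    refine (condExp_sub integrable_condExp integrable_condExp _).trans
      ((condExp_condExp_of_le (hF h1) (hle m)).sub ?_)
    rw [condExp_of_stronglyMeasurable (hle n)
      (stronglyMeasurable_condExp.mono (hF h2)) integrable_condExp]
  have hall : ∀ᵐ ω ∂μ, ∀ n, m ≤ n → n ≤ N →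
      (μ[h | F n]) ω = (μ[f | F n]) ω - (μ[f | F N]) ω := by
    simp_rw [ae_all_iff]
    exact fun n h1 h2 => hcond n h1 h2
  calc _ ≤ ε * μ {ω | (ε : ℝ) ≤ (Finset.range (N - m + 1)).sup' Finset.nonempty_range_add_one
          fun k => |(μ[h | 𝒢 k]) ω|} := by
        refine mul_le_mul_right (measure_mono_ae ?_) _
        filter_upwards [hall] with ω hω
        rintro ⟨n, h1, h2, h3⟩
        refine h3.trans ?_
        rw [← hω n h1 h2]
        have hk : N - n ∈ Finset.range (N - m + 1) := by simp; omega
        refine le_trans (le_of_eq ?_) (Finset.le_sup' (fun k => |(μ[h | 𝒢 k]) ω|) hk)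
        change _ = |(μ[h | F (N - (N - n))]) ω|
        rw [show N - (N - n) = n by omega]
    _ ≤ _ := hmax
    _ ≤ _ := by
        refine ENNReal.ofReal_le_ofReal ?_
        refine (setIntegral_le_integral integrable_condExp.abs
          (ae_of_all _ fun ω => abs_nonneg _)).trans ?_
        exact integral_abs_condExp_le h

/-- Almost sure convergence of square integrable backward martingales. -/
theorem ae_exists_tendsto_condExp_antitone (hF : Antitone F) (hle : ∀ n, F n ≤ m0) {f : Ω → ℝ}
    (hf : MemLp f 2 μ) :
    ∀ᵐ ω ∂μ, ∃ c, Tendsto (fun n => (μ[f | F n]) ω) atTop (𝓝 c) := by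
  set g : ℕ → Ω → ℝ := fun n => μ[f | F n] with hg
  have hgL : ∀ n, MemLp (g n) 2 μ := fun n => hf.condExp (by norm_num)
  set a : ℕ → ℝ := fun n => ∫ ω, g n ω ^ 2 ∂μ with ha
  have hdiff : ∀ m N, m ≤ N → ∫ ω, (g m ω - g N ω) ^ 2 ∂μ = a m - a N :=
    fun m N h => integral_condExp_sub_sq_of_le (hF h) (hle m) hf
  have hanti : Antitone a := fun m N h => by
    have h0 : 0 ≤ ∫ ω, (g m ω - g N ω) ^ 2 ∂μ := integral_nonneg fun ω => sq_nonneg _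
    linarith [hdiff m N h]
  have hbdd : BddBelow (Set.range a) :=
    ⟨0, by rintro _ ⟨n, rfl⟩; exact integral_nonneg fun ω => sq_nonneg _⟩
  have hlim := tendsto_atTop_ciInf hanti hbdd
  set l := ⨅ n, a n with hl
  have hal : ∀ n, l ≤ a n := fun n => ciInf_le hbdd n
  -- The bound `2|x| ≤ δ + δ⁻¹ x²` passes from L² to L¹ without square roots. Later `m → ∞` with `δ`
  -- fixed, and only then `δ → 0`.
  have hL1 : ∀ m N, m ≤ N → ∀ δ : ℝ, 0 < δ →
      ∫ ω, |g m ω - g N ω| ∂μ ≤ δ * μ.real Set.univ + δ⁻¹ * (a m - l) := by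
    intro m N h δ hδ
    have hi : Integrable (fun ω => (g m ω - g N ω) ^ 2) μ := ((hgL m).sub (hgL N)).integrable_sq
    calc ∫ ω, |g m ω - g N ω| ∂μ ≤ ∫ ω, (δ + δ⁻¹ * (g m ω - g N ω) ^ 2) ∂μ := by
          refine integral_mono (integrable_condExp.sub integrable_condExp).abs
            ((integrable_const _).add (hi.const_mul _)) fun ω => ?_
          dsimp only
          have h1 : 0 ≤ δ⁻¹ * (|g m ω - g N ω| - δ) ^ 2 := by positivity
          have h2 : δ⁻¹ * (|g m ω - g N ω| - δ) ^ 2 =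
              δ⁻¹ * (g m ω - g N ω) ^ 2 - 2 * |g m ω - g N ω| + δ := by
            rw [sub_sq, sq_abs]; field_simp
          have h3 := abs_nonneg (g m ω - g N ω)
          linarith
      _ = δ * μ.real Set.univ + δ⁻¹ * (a m - a N) := by
          rw [integral_add (integrable_const _) (hi.const_mul _), integral_const_mul,
            hdiff m N h, integral_const, smul_eq_mul, mul_comm]
      _ ≤ _ := by
          gcongr
          exact hal N
  -- Oscillation between times `m` and `N`. The factor 2 pays for comparing both terms with the one
  -- at `N`; paths outside these sets for all `ε = 1/(k+1)` are Cauchy.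
  let D : ℝ≥0 → ℕ → ℕ → Set Ω := fun ε m N =>
    {ω | ∃ n n', m ≤ n ∧ n ≤ N ∧ m ≤ n' ∧ n' ≤ N ∧ 2 * (ε : ℝ) ≤ |g n ω - g n' ω|}
  have hD : ∀ ε m N, m ≤ N → ∀ δ : ℝ, 0 < δ →
      ε * μ (D ε m N) ≤ ENNReal.ofReal (δ * μ.real Set.univ + δ⁻¹ * (a m - l)) := by
    intro ε m N h δ hδ
    refine le_trans (mul_le_mul_right (measure_mono ?_) _) ((backward_maximal_ineq hF hle f ε h).trans
      (ENNReal.ofReal_le_ofReal (hL1 m N h δ hδ)))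
    rintro ω ⟨n, n', h1, h2, h3, h4, h5⟩
    by_contra hcon
    simp only [Set.mem_ofPred_eq, not_exists, not_and, not_le] at hcon
    have e1 := hcon n h1 h2
    have e2 := hcon n' h3 h4
    have e3 := abs_sub_le (g n ω) (g N ω) (g n' ω)
    rw [abs_sub_comm (g N ω)] at e3
    change |g n ω - g N ω| < _ at e1
    change |g n' ω - g N ω| < _ at e2
    linarith
  have hU : ∀ ε m, ∀ δ : ℝ, 0 < δ →
      ε * μ (⋃ N, D ε m N) ≤ ENNReal.ofReal (δ * μ.real Set.univ + δ⁻¹ * (a m - l)) := by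
    intro ε m δ hδ
    have hmono : Monotone (D ε m) := by
      rintro N N' hN ω ⟨n, n', h1, h2, h3, h4, h5⟩
      exact ⟨n, n', h1, h2.trans hN, h3, h4.trans hN, h5⟩
    have ht := tendsto_measure_iUnion_atTop (μ := μ) hmono
    have ht' := ENNReal.Tendsto.const_mul ht (a := (ε : ℝ≥0∞)) (Or.inr ENNReal.coe_ne_top)
    refine le_of_tendsto ht' ?_
    filter_upwards [eventually_ge_atTop m] with N hN using hD ε m N hN δ hδ
  have hnull : ∀ ε : ℝ≥0, 0 < ε → μ (⋂ m, ⋃ N, D ε m N) = 0 := by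
    intro ε hε
    have h1 : ∀ δ : ℝ, 0 < δ →
        ε * μ (⋂ m, ⋃ N, D ε m N) ≤ ENNReal.ofReal (δ * μ.real Set.univ) := by
      intro δ hδ
      have ht : Tendsto (fun m => ENNReal.ofReal (δ * μ.real Set.univ + δ⁻¹ * (a m - l))) atTop
          (𝓝 (ENNReal.ofReal (δ * μ.real Set.univ + δ⁻¹ * (l - l)))) :=
        ENNReal.tendsto_ofReal (((hlim.sub_const l).const_mul _).const_add _)
      rw [sub_self, mul_zero, add_zero] at ht
      refine ge_of_tendsto' ht fun m => le_trans ?_ (hU ε m δ hδ)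
      exact mul_le_mul_right (measure_mono (Set.iInter_subset _ m)) _
    have h2 : ε * μ (⋂ m, ⋃ N, D ε m N) ≤ 0 := by
      have ht : Tendsto (fun δ : ℝ => ENNReal.ofReal (δ * μ.real Set.univ)) (𝓝[>] 0)
          (𝓝 (ENNReal.ofReal (0 * μ.real Set.univ))) :=
        ENNReal.tendsto_ofReal ((tendsto_nhdsWithin_of_tendsto_nhds tendsto_id).mul_const _)
      rw [zero_mul, ENNReal.ofReal_zero] at ht
      refine ge_of_tendsto ht ?_
      filter_upwards [self_mem_nhdsWithin] with δ hδ using h1 δ hδ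
    rcases mul_eq_zero.1 (le_antisymm h2 bot_le) with h | h
    · exact absurd h (by exact_mod_cast hε.ne')
    · exact h
  have hae : ∀ᵐ ω ∂μ, ∀ k : ℕ, ω ∉ ⋂ m, ⋃ N, D ((k : ℝ≥0) + 1)⁻¹ m N := by
    rw [ae_all_iff]
    exact fun k => measure_eq_zero_iff_ae_notMem.1 (hnull _ (by positivity))
  filter_upwards [hae] with ω hω
  refine cauchySeq_tendsto_of_complete (Metric.cauchySeq_iff.2 fun ε hε => ?_)
  obtain ⟨k, hk⟩ := exists_nat_one_div_lt (show 0 < ε / 2 by linarith)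
  have := hω k
  simp only [Set.mem_iInter, Set.mem_iUnion, not_forall, not_exists] at this
  obtain ⟨m, hm⟩ := this
  refine ⟨m, fun n hn n' hn' => ?_⟩
  by_contra hcon
  rw [not_lt, Real.dist_eq] at hcon
  refine hm (max n n') ⟨n, n', hn, le_max_left _ _, hn', le_max_right _ _, ?_⟩
  have e : (((k : ℝ≥0) + 1)⁻¹ : ℝ≥0) = (1 : ℝ) / ((k : ℝ) + 1) := by push_cast; rw [one_div]
  rw [e]
  change _ ≤ |g n ω - g n' ω|
  change ε ≤ |g n ω - g n' ω| at hcon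
  linarith

end BackwardMartingale

/-! ### Cylinders: a countable generating π-system. -/

/-- The class of all cylinders of the configuration space `S → E`. -/
def spinCylinders (S E : Type*) : Set (Set (S → E)) :=
  {C | ∃ (Δ : Finset S) (σ : S → E), spinCylinder Δ σ = C}

section Cylinders

variable {S E : Type*}

theorem isPiSystem_spinCylinders : IsPiSystem (spinCylinders S E) := by
  classical
  rintro _ ⟨Δ, σ, rfl⟩ _ ⟨Δ', σ', rfl⟩ ⟨τ, h, h'⟩
  refine ⟨Δ ∪ Δ', τ, ?_⟩
  ext ω
  constructor
  · intro hω
    exact ⟨fun i hi => (hω i (Finset.mem_union_left _ hi)).trans (h i hi),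
      fun i hi => (hω i (Finset.mem_union_right _ hi)).trans (h' i hi)⟩
  · rintro ⟨h1, h2⟩ i hi
    rcases Finset.mem_union.1 hi with hi | hi
    · exact (h1 i hi).trans (h i hi).symm
    · exact (h2 i hi).trans (h' i hi).symm

theorem countable_spinCylinders [Countable S] [Finite E] : (spinCylinders S E).Countable := by
  refine (Set.countable_range fun p : Σ Δ : Finset S, (Δ → E) =>
    {ω : S → E | ∀ i : p.1, ω i = p.2 i}).mono ?_
  rintro _ ⟨Δ, σ, rfl⟩
  refine ⟨⟨Δ, fun i => σ i⟩, ?_⟩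
  ext ω
  exact ⟨fun h i hi => h ⟨i, hi⟩, fun h i => h i i.2⟩

variable [MeasurableSpace E] [DiscreteMeasurableSpace E]

theorem measurableSet_spinCylinder (Δ : Finset S) (σ : S → E) :
    MeasurableSet (spinCylinder Δ σ) := by
  have : spinCylinder Δ σ = ⋂ i ∈ Δ, (fun ω : S → E => ω i) ⁻¹' {σ i} := by
    ext ω; simp [spinCylinder]
  rw [this]
  exact Finset.measurableSet_biInter _ fun i _ => measurable_pi_apply i (MeasurableSet.of_discrete)

theorem measurableSet_of_mem_spinCylinders {C : Set (S → E)} (hC : C ∈ spinCylinders S E) :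
    MeasurableSet C := by
  obtain ⟨Δ, σ, rfl⟩ := hC
  exact measurableSet_spinCylinder Δ σ

theorem generateFrom_spinCylinders [Finite E] :
    (MeasurableSpace.pi : MeasurableSpace (S → E)) =
      MeasurableSpace.generateFrom (spinCylinders S E) := by
  apply le_antisymm
  · refine iSup_le fun i => ?_
    rw [← measurable_iff_comap_le]
    have : Countable E := Finite.to_countable
    refine @measurable_to_countable' E (S → E) _ _ (MeasurableSpace.generateFrom _) _ fun e => ?_
    refine MeasurableSpace.measurableSet_generateFrom ⟨{i}, fun _ => e, ?_⟩
    ext ω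
    simp [spinCylinder]
  · exact MeasurableSpace.generateFrom_le fun C hC => measurableSet_of_mem_spinCylinders hC

theorem measure_ext_spinCylinders [Finite E] {μ ν : Measure (S → E)} [IsFiniteMeasure μ]
    (huniv : μ Set.univ = ν Set.univ) (h : ∀ C ∈ spinCylinders S E, μ C = ν C) : μ = ν :=
  ext_of_generate_finite _ generateFrom_spinCylinders isPiSystem_spinCylinders h huniv

end Cylinders

/-! ### The outside and tail σ-algebras. -/

section Outside

variable {S E : Type*} [MeasurableSpace E]

theorem outsideSigma_le (Λ : Finset S) :
    outsideSigma (E := E) Λ ≤ (MeasurableSpace.pi : MeasurableSpace (S → E)) :=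
  cylinderEvents_le_pi

theorem outsideSigma_anti {Λ Λ' : Finset S} (h : Λ ⊆ Λ') :
    outsideSigma (E := E) Λ' ≤ outsideSigma Λ :=
  cylinderEvents_mono (Set.compl_subset_compl.2 (Finset.coe_subset.2 h))

theorem tailSigma_le_outsideSigma (Λ : Finset S) : tailSigma S E ≤ outsideSigma Λ :=
  iInf_le _ Λ

theorem tailSigma_le : tailSigma S E ≤ (MeasurableSpace.pi : MeasurableSpace (S → E)) :=
  (tailSigma_le_outsideSigma ∅).trans (outsideSigma_le ∅)

end Outside

/-! ### DLR measures as invariant measures. -/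

section DLR

variable {S E : Type*} [MeasurableSpace E] {γ : Finset S → Kernel (S → E) (S → E)}

/-- By properness, `γ Λ ω` gives mass zero either to `B` or to its complement, according to `ω`. -/
theorem IsSpecification.apply_inter (hγ : IsSpecification γ) (Λ : Finset S) (ω : S → E)
    (A : Set (S → E)) {B : Set (S → E)} (hB : MeasurableSet[outsideSigma Λ] B) :
    γ Λ ω (A ∩ B) = B.indicator (fun ω => γ Λ ω A) ω := by
  have hp := hγ.proper Λ ω B hB
  by_cases hω : ω ∈ B
  · have hc := hγ.proper Λ ω Bᶜ hB.compl
    rw [Set.indicator_of_notMem (by simpa using hω)] at hc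
    rw [Set.indicator_of_mem hω]
    exact measure_inter_conull hc
  · rw [Set.indicator_of_notMem hω] at hp ⊢
    exact measure_mono_null Set.inter_subset_right hp

theorem IsSpecification.measurable (hγ : IsSpecification γ) (Λ : Finset S) {A : Set (S → E)}
    (hA : MeasurableSet A) : Measurable fun ω => γ Λ ω A :=
  (hγ.measurable_outside Λ A hA).mono cylinderEvents_le_pi le_rfl

/-- Outside events can be pulled out of the equilibrium equation. -/
theorem IsSpecification.setLIntegral_apply (hγ : IsSpecification γ) {Λ : Finset S}
    {μ : Measure (S → E)} (hμ : μ.bind (γ Λ) = μ) {A B : Set (S → E)} (hA : MeasurableSet A)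
    (hB : MeasurableSet[outsideSigma Λ] B) : ∫⁻ ω in B, γ Λ ω A ∂μ = μ (A ∩ B) := by
  have hB' : MeasurableSet B := cylinderEvents_le_pi _ hB
  rw [← lintegral_indicator hB']
  conv_rhs => rw [← hμ, Measure.bind_apply (hA.inter hB') (γ Λ).aemeasurable]
  exact lintegral_congr fun ω => (hγ.apply_inter Λ ω A hB).symm

/-- The DLR equations amount to invariance under all kernels of the specification. -/
theorem IsSpecification.mem_dlrMeasures_iff (hγ : IsSpecification γ) {μ : Measure (S → E)} :
    μ ∈ dlrMeasures γ ↔ IsProbabilityMeasure μ ∧ ∀ Λ, μ.bind (γ Λ) = μ := by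
  refine and_congr_right fun hprob => ⟨fun h Λ => ?_, fun h Λ A hA => ?_⟩
  · have := hγ.isMarkovKernel Λ
    ext A hA
    rw [Measure.bind_apply hA (γ Λ).aemeasurable]
    have h1 : ∫ ω, (γ Λ ω).real A ∂μ = μ.real A := by
      rw [← integral_congr_ae (h Λ A hA), integral_condExp cylinderEvents_le_pi,
        integral_indicator_const _ hA]
      simp
    have h2 : ∫ ω, (γ Λ ω).real A ∂μ = (∫⁻ ω, γ Λ ω A ∂μ).toReal :=
      integral_toReal (hγ.measurable Λ hA).aemeasurable (ae_of_all _ fun ω => measure_lt_top _ _)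
    have hfin : ∫⁻ ω, γ Λ ω A ∂μ ≠ ∞ := by
      refine ne_top_of_le_ne_top ENNReal.one_ne_top ?_
      calc ∫⁻ ω, γ Λ ω A ∂μ ≤ ∫⁻ ω, 1 ∂μ := lintegral_mono fun ω => prob_le_one
        _ = 1 := by simp
    exact (ENNReal.toReal_eq_toReal_iff' hfin (measure_ne_top _ _)).1 (h2.symm.trans h1)
  · have := hγ.isMarkovKernel Λ
    have hm := hγ.measurable_outside Λ A hA
    have hint : Integrable (fun ω => (γ Λ ω).real A) μ := by
      refine Integrable.of_bound (C := 1)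
        (hγ.measurable Λ hA).ennreal_toReal.aestronglyMeasurable (ae_of_all _ fun ω => ?_)
      rw [Real.norm_of_nonneg measureReal_nonneg]
      exact measureReal_le_one
    symm
    refine ae_eq_condExp_of_forall_setIntegral_eq cylinderEvents_le_pi
      ((integrable_const 1).indicator hA) (fun s _ _ => hint.integrableOn) (fun B hB _ => ?_)
      (hm.ennreal_toReal.stronglyMeasurable.aestronglyMeasurable)
    have h2 : ∫ ω in B, (γ Λ ω).real A ∂μ = (∫⁻ ω in B, γ Λ ω A ∂μ).toReal :=
      integral_toReal (hγ.measurable Λ hA).aemeasurable (ae_of_all _ fun ω => measure_lt_top _ _)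
    rw [h2, hγ.setLIntegral_apply (h Λ) hA hB, integral_indicator_const _ hA]
    simp [Measure.real, Measure.restrict_apply hA]

theorem IsSpecification.convex_dlrMeasures (hγ : IsSpecification γ) :
    Convex ℝ≥0 (dlrMeasures γ) := by
  intro μ hμ ν hν a b _ _ hab
  rw [hγ.mem_dlrMeasures_iff] at hμ hν ⊢
  obtain ⟨_, hμ⟩ := hμ
  obtain ⟨_, hν⟩ := hν
  refine ⟨⟨?_⟩, fun Λ => ?_⟩
  · simp only [Measure.add_apply, Measure.smul_apply, measure_univ, ENNReal.smul_def,
      smul_eq_mul, mul_one]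
    exact_mod_cast hab
  · ext A hA
    have h1 : ∫⁻ ω, γ Λ ω A ∂μ = μ A := by
      rw [← Measure.bind_apply hA (γ Λ).aemeasurable, hμ]
    have h2 : ∫⁻ ω, γ Λ ω A ∂ν = ν A := by
      rw [← Measure.bind_apply hA (γ Λ).aemeasurable, hν]
    rw [Measure.bind_apply hA (γ Λ).aemeasurable, lintegral_add_measure, lintegral_smul_measure,
      lintegral_smul_measure, h1, h2]
    simp

/-- A tail event is an outside event for every `Λ`, so restricting to it preserves all the
invariance equations. -/
theorem IsSpecification.cond_mem_dlrMeasures (hγ : IsSpecification γ) {μ : Measure (S → E)}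
    (hμ : μ ∈ dlrMeasures γ) {B : Set (S → E)} (hB : MeasurableSet[tailSigma S E] B)
    (hB0 : μ B ≠ 0) : μ[|B] ∈ dlrMeasures γ := by
  rw [hγ.mem_dlrMeasures_iff] at hμ ⊢
  obtain ⟨_, hμ⟩ := hμ
  refine ⟨cond_isProbabilityMeasure hB0, fun Λ => ?_⟩
  have hBΛ : MeasurableSet[outsideSigma Λ] B := iInf_le outsideSigma Λ B hB
  have hB' : MeasurableSet B := cylinderEvents_le_pi _ hBΛ
  ext A hA
  rw [Measure.bind_apply hA (γ Λ).aemeasurable, ProbabilityTheory.cond, lintegral_smul_measure,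
    hγ.setLIntegral_apply (hμ Λ) hA hBΛ, Measure.smul_apply, Measure.restrict_apply hA]

end DLR

/-! ### Infinite-volume limits and tail triviality. -/

section TailLimit

variable {S E : Type*} [MeasurableSpace E] {γ : Finset S → Kernel (S → E) (S → E)}
  {Λ : ℕ → Finset S}

/-- The upper limit of `γ_{Λ n}(A | ·)` along a sequence of volumes. -/
noncomputable def tailLimsup (γ : Finset S → Kernel (S → E) (S → E)) (Λ : ℕ → Finset S)
    (A : Set (S → E)) (ω : S → E) : ℝ≥0∞ :=
  limsup (fun n => γ (Λ n) ω A) atTop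

theorem eventually_subset_of_exhausting (hmono : Monotone Λ) (hex : ∀ i, ∃ n, i ∈ Λ n)
    (Δ : Finset S) : ∃ n, Δ ⊆ Λ n := by
  classical
  induction Δ using Finset.induction_on with
  | empty => exact ⟨0, Finset.empty_subset _⟩
  | insert i Δ _ ih =>
    obtain ⟨n, hn⟩ := ih
    obtain ⟨k, hk⟩ := hex i
    exact ⟨max n k, Finset.insert_subset (hmono (le_max_right n k) hk)
      (hn.trans (hmono (le_max_left n k)))⟩

/-- Dropping finitely many terms leaves the upper limit unchanged, and once `Λ n` contains `Δ` every
term is measurable outside `Δ`. -/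
theorem IsSpecification.measurable_tailLimsup (hγ : IsSpecification γ) (hmono : Monotone Λ)
    (hex : ∀ i, ∃ n, i ∈ Λ n) {A : Set (S → E)} (hA : MeasurableSet A) :
    Measurable[tailSigma S E] (tailLimsup γ Λ A) := by
  intro U hU
  refine MeasurableSpace.measurableSet_iInf.2 fun Δ => ?_
  obtain ⟨N, hN⟩ := eventually_subset_of_exhausting hmono hex Δ
  have e : tailLimsup γ Λ A = fun ω => limsup (fun n => γ (Λ (n + N)) ω A) atTop := by
    funext ω
    exact (limsup_nat_add (fun n => γ (Λ n) ω A) N).symm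
  have hm : Measurable[outsideSigma Δ] (tailLimsup γ Λ A) := by
    rw [e]
    refine Measurable.limsup (mδ := outsideSigma Δ) fun n => ?_
    exact (hγ.measurable_outside _ A hA).mono
      (outsideSigma_anti (hN.trans (hmono (Nat.le_add_left N n)))) le_rfl
  exact hm hU

theorem IsSpecification.tailLimsup_le_one (hγ : IsSpecification γ) (A : Set (S → E))
    (ω : S → E) : tailLimsup γ Λ A ω ≤ 1 := by
  refine limsup_le_of_le (by isBoundedDefault) (Eventually.of_forall fun n => ?_)
  have := hγ.isMarkovKernel (Λ n)
  exact prob_le_one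

/-- Along an exhausting sequence of volumes the finite volume conditional probabilities converge
almost surely. -/
theorem IsSpecification.ae_tendsto_tailLimsup (hγ : IsSpecification γ) (hmono : Monotone Λ)
    {μ : Measure (S → E)} (hμ : μ ∈ dlrMeasures γ) {A : Set (S → E)} (hA : MeasurableSet A) :
    ∀ᵐ ω ∂μ, Tendsto (fun n => γ (Λ n) ω A) atTop (𝓝 (tailLimsup γ Λ A ω)) := by
  obtain ⟨hprob, hμ⟩ := hμ
  have hconv := ae_exists_tendsto_condExp_antitone (μ := μ) (F := fun n => outsideSigma (Λ n))
    (fun m n h => outsideSigma_anti (hmono h)) (fun n => cylinderEvents_le_pi)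
    (f := A.indicator fun _ => (1 : ℝ)) ((memLp_const 1).indicator hA)
  have hall : ∀ᵐ ω ∂μ, ∀ n, (μ⟦A | outsideSigma (Λ n)⟧) ω = (γ (Λ n) ω).real A :=
    ae_all_iff.2 fun n => hμ (Λ n) A hA
  filter_upwards [hconv, hall] with ω ⟨c, hc⟩ hω
  have h1 : Tendsto (fun n => γ (Λ n) ω A) atTop (𝓝 (ENNReal.ofReal c)) := by
    refine (ENNReal.tendsto_ofReal hc).congr fun n => ?_
    have := hγ.isMarkovKernel (Λ n)
    rw [hω n, ofReal_measureReal]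
  rwa [tailLimsup, h1.limsup_eq]

/-- The limit of the finite volume conditional probabilities is a version of the conditional
probability given the tail σ-algebra. -/
theorem IsSpecification.setLIntegral_tailLimsup (hγ : IsSpecification γ) (hmono : Monotone Λ)
    {μ : Measure (S → E)} (hμ : μ ∈ dlrMeasures γ) {A B : Set (S → E)} (hA : MeasurableSet A)
    (hB : MeasurableSet[tailSigma S E] B) :
    ∫⁻ ω in B, tailLimsup γ Λ A ω ∂μ = μ (A ∩ B) := by
  have hlim := hγ.ae_tendsto_tailLimsup hmono hμ hA
  obtain ⟨hprob, hinv⟩ := hγ.mem_dlrMeasures_iff.1 hμ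
  have ht := tendsto_lintegral_of_dominated_convergence (μ := μ.restrict B) (fun _ => 1)
    (fun n => hγ.measurable (Λ n) hA)
    (fun n => ae_of_all _ fun ω => by
      have := hγ.isMarkovKernel (Λ n)
      exact prob_le_one)
    (by simp) (ae_restrict_of_ae hlim)
  refine tendsto_nhds_unique ht ?_
  simp_rw [hγ.setLIntegral_apply (hinv _) hA (iInf_le outsideSigma _ B hB)]
  exact tendsto_const_nhds

theorem exists_exhausting (S : Type*) [Countable S] :
    ∃ Λ : ℕ → Finset S, Monotone Λ ∧ ∀ i, ∃ n, i ∈ Λ n := by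
  classical
  obtain ⟨e, he⟩ := exists_injective_nat S
  refine ⟨fun n => (Finset.range n).preimage e he.injOn, fun m n h => ?_, fun i => ⟨e i + 1, ?_⟩⟩
  · intro i hi
    simp only [Finset.mem_preimage, Finset.mem_range] at hi ⊢
    omega
  · simp

variable [Countable S]

/-- Each measure of `A` is the integral of the same tail-measurable function `tailLimsup γ Λ A`. -/
theorem IsSpecification.eq_of_tailSigma (hγ : IsSpecification γ) {μ ν : Measure (S → E)}
    (hμ : μ ∈ dlrMeasures γ) (hν : ν ∈ dlrMeasures γ)
    (h : ∀ B, MeasurableSet[tailSigma S E] B → μ B = ν B) : μ = ν := by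
  obtain ⟨Λ, hmono, hex⟩ := exists_exhausting S
  ext A hA
  have h1 := hγ.setLIntegral_tailLimsup hmono hμ hA MeasurableSet.univ
  have h2 := hγ.setLIntegral_tailLimsup hmono hν hA MeasurableSet.univ
  rw [Measure.restrict_univ, Set.inter_univ] at h1 h2
  have htr : μ.trim tailSigma_le = ν.trim tailSigma_le := by
    refine @Measure.ext _ (tailSigma S E) _ _ fun B hB => ?_
    rw [trim_measurableSet_eq _ hB, trim_measurableSet_eq _ hB, h B hB]
  have hm := hγ.measurable_tailLimsup hmono hex hA
  rw [← h1, ← h2, ← lintegral_trim tailSigma_le hm, ← lintegral_trim tailSigma_le hm, htr]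

/-- A tail event of intermediate mass splits `μ` into two conditioned DLR measures, contradicting
extremality. Conversely, a component of a tail-trivial mixture is absolutely continuous with respect
to it, so both agree on tail events and hence everywhere. -/
theorem IsSpecification.extremeDLR_eq (hγ : IsSpecification γ) :
    extremeDLR γ =
      {μ ∈ dlrMeasures γ | ∀ B, MeasurableSet[tailSigma S E] B → μ B = 0 ∨ μ B = 1} := by
  ext μ
  constructor
  · intro hμ
    have hG := hμ.1
    have := hG.1
    refine ⟨hG, fun B hB => ?_⟩
    by_contra! hcon
    have hB' : MeasurableSet B := tailSigma_le _ hB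
    have hc0 : μ Bᶜ ≠ 0 := by
      intro h0
      exact hcon.2 ((prob_compl_eq_zero_iff hB').1 h0)
    have hseg : μ ∈ openSegment ℝ≥0 (μ[|B]) (μ[|Bᶜ]) := by
      refine ⟨(μ B).toNNReal, (μ Bᶜ).toNNReal, ENNReal.toNNReal_pos hcon.1 (measure_ne_top _ _),
        ENNReal.toNNReal_pos hc0 (measure_ne_top _ _), ?_, ?_⟩
      · rw [← ENNReal.toNNReal_add (measure_ne_top _ _) (measure_ne_top _ _),
          prob_add_prob_compl hB', ENNReal.toNNReal_one]
      · ext A hA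
        simp only [Measure.add_apply, Measure.smul_apply, ENNReal.smul_def, smul_eq_mul,
          ENNReal.coe_toNNReal (measure_ne_top μ _)]
        rw [mul_comm, cond_mul_eq_inter hB', mul_comm, cond_mul_eq_inter hB'.compl,
          Set.inter_comm, Set.inter_comm Bᶜ]
        exact measure_inter_add_sdiff A hB'
    have he := hμ.2 (hγ.cond_mem_dlrMeasures hG hB hcon.1)
      (hγ.cond_mem_dlrMeasures hG hB.compl hc0) hseg
    refine hcon.2 ?_
    rw [← he, cond_apply_self hcon.1 (measure_ne_top _ _)]
  · rintro ⟨hG, htriv⟩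
    refine ⟨hG, fun ν₁ h₁ ν₂ h₂ hseg => hγ.eq_of_tailSigma h₁ hG fun B hB => ?_⟩
    obtain ⟨a, b, ha, hb, hab, rfl⟩ := hseg
    have := h₁.1
    have := h₂.1
    have := hG.1
    have hzero : ∀ B, (a • ν₁ + b • ν₂) B = 0 → ν₁ B = 0 := by
      intro B h0
      simp only [Measure.add_apply, Measure.smul_apply, ENNReal.smul_def, smul_eq_mul,
        add_eq_zero, mul_eq_zero, ENNReal.coe_eq_zero, ha.ne', false_or] at h0
      exact h0.1
    rcases htriv B hB with h0 | h0
    · rw [h0, hzero B h0]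
    · have hB' : MeasurableSet B := tailSigma_le _ hB
      rw [h0]
      exact (prob_compl_eq_zero_iff hB').1 (hzero _ ((prob_compl_eq_zero_iff hB').2 h0))

theorem IsSpecification.exists_tail_separating (hγ : IsSpecification γ) {μ ν : Measure (S → E)}
    (hμ : μ ∈ extremeDLR γ) (hν : ν ∈ extremeDLR γ) (hne : μ ≠ ν) :
    ∃ B, MeasurableSet[tailSigma S E] B ∧ μ B = 1 ∧ ν B = 0 := by
  rw [hγ.extremeDLR_eq] at hμ hν
  have := hμ.1.1
  have := hν.1.1
  by_contra! hcon
  refine hne (hγ.eq_of_tailSigma hμ.1 hν.1 fun B hB => ?_)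
  have hB' : MeasurableSet B := tailSigma_le _ hB
  rcases hμ.2 B hB with h | h <;> rcases hν.2 B hB with h' | h'
  · rw [h, h']
  · exact absurd ((prob_compl_eq_zero_iff hB').2 h')
      (hcon Bᶜ hB.compl ((prob_compl_eq_one_iff hB').2 h))
  · exact absurd h' (hcon B hB h)
  · rw [h, h']

end TailLimit

/-! ### Almost sure identities from integrals. -/

theorem ae_eq_of_forall_setLIntegral_eq_of_le {Ω : Type*} {m m0 : MeasurableSpace Ω}
    (hm : m ≤ m0) {μ : Measure Ω} [IsFiniteMeasure μ] {f g : Ω → ℝ≥0∞} (hf : Measurable[m] f)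
    (hg : Measurable[m] g)
    (h : ∀ B, MeasurableSet[m] B → ∫⁻ ω in B, f ω ∂μ = ∫⁻ ω in B, g ω ∂μ) : f =ᵐ[μ] g := by
  refine ae_eq_of_ae_eq_trim (hm := hm)
    (ae_eq_of_forall_setLIntegral_eq_of_sigmaFinite hf hg fun B hB _ => ?_)
  rw [restrict_trim hm μ hB, lintegral_trim hm hf, lintegral_trim hm hg, h B hB]

/-- The variance of `g` vanishes. -/
theorem ae_eq_const_of_lintegral_sq_eq {Ω : Type*} [MeasurableSpace Ω] {ν : Measure Ω}
    [IsProbabilityMeasure ν] {g : Ω → ℝ≥0∞} (hg : Measurable g) (hg1 : ∀ ω, g ω ≤ 1)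
    {c : ℝ≥0∞} (h1 : ∫⁻ ω, g ω ∂ν = c) (h2 : ∫⁻ ω, g ω ^ 2 ∂ν = c ^ 2) :
    ∀ᵐ ω ∂ν, g ω = c := by
  have hgt : ∀ ω, g ω ≠ ∞ := fun ω => ne_top_of_le_ne_top ENNReal.one_ne_top (hg1 ω)
  have hc : c ≠ ∞ := by
    rw [← h1]
    refine ne_top_of_le_ne_top ENNReal.one_ne_top ((lintegral_mono hg1).trans ?_)
    simp
  have hG1 : ∀ ω, (g ω).toReal ≤ 1 := fun ω => by
    simpa using ENNReal.toReal_mono ENNReal.one_ne_top (hg1 ω)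
  have hi1 : Integrable (fun ω => (g ω).toReal) ν :=
    Integrable.of_bound (C := 1) hg.ennreal_toReal.aestronglyMeasurable
      (ae_of_all _ fun ω => by rw [Real.norm_of_nonneg ENNReal.toReal_nonneg]; exact hG1 ω)
  have hi2 : Integrable (fun ω => (g ω).toReal ^ 2) ν :=
    Integrable.of_bound (C := 1) (hg.ennreal_toReal.pow_const 2).aestronglyMeasurable
      (ae_of_all _ fun ω => by
        rw [Real.norm_of_nonneg (by positivity)]
        exact pow_le_one₀ ENNReal.toReal_nonneg (hG1 ω))
  have e1 : ∫ ω, (g ω).toReal ∂ν = c.toReal := by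
    rw [integral_toReal hg.aemeasurable (ae_of_all _ fun ω => (hgt ω).lt_top), h1]
  have e2 : ∫ ω, (g ω).toReal ^ 2 ∂ν = c.toReal ^ 2 := by
    rw [← ENNReal.toReal_pow, ← h2, ← integral_toReal (hg.pow_const 2).aemeasurable
      (ae_of_all _ fun ω => ENNReal.pow_lt_top (hgt ω).lt_top)]
    simp
  have hi3 : Integrable (fun ω => (g ω).toReal ^ 2 - 2 * c.toReal * (g ω).toReal) ν :=
    hi2.sub (hi1.const_mul _)
  have e : ∀ ω, ((g ω).toReal - c.toReal) ^ 2 =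
      (g ω).toReal ^ 2 - 2 * c.toReal * (g ω).toReal + c.toReal ^ 2 := fun ω => by ring
  have hzero : ∫ ω, ((g ω).toReal - c.toReal) ^ 2 ∂ν = 0 := by
    simp_rw [e]
    rw [integral_add hi3 (integrable_const _), integral_sub hi2 (hi1.const_mul _),
      integral_const_mul, e1, e2]
    simp
    ring
  have hi4 : Integrable (fun ω => ((g ω).toReal - c.toReal) ^ 2) ν := by
    simp_rw [e]
    exact hi3.add (integrable_const _)
  filter_upwards [(integral_eq_zero_iff_of_nonneg (fun ω => sq_nonneg _) hi4).1 hzero] with ω hω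
  have : (g ω).toReal = c.toReal := sub_eq_zero.1 (pow_eq_zero_iff two_ne_zero |>.1 hω)
  exact (ENNReal.toReal_eq_toReal_iff' (hgt ω) hc).1 this

/-! ### Extremality as countably many measurable conditions. -/

section Extreme

variable {S E : Type*} [MeasurableSpace E] {γ : Finset S → Kernel (S → E) (S → E)}
  {Λ : ℕ → Finset S} [Countable S]

/-- Under an extreme DLR measure the limiting conditional probabilities are constant. -/
theorem IsSpecification.ae_tailLimsup_eq_const (hγ : IsSpecification γ) (hmono : Monotone Λ)
    (hex : ∀ i, ∃ n, i ∈ Λ n) {ν : Measure (S → E)} (hν : ν ∈ extremeDLR γ)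
    {A : Set (S → E)} (hA : MeasurableSet A) : ∀ᵐ ω ∂ν, tailLimsup γ Λ A ω = ν A := by
  rw [hγ.extremeDLR_eq] at hν
  have := hν.1.1
  refine ae_eq_of_forall_setLIntegral_eq_of_le tailSigma_le
    (hγ.measurable_tailLimsup hmono hex hA) measurable_const fun B hB => ?_
  have hB' : MeasurableSet B := tailSigma_le _ hB
  rw [hγ.setLIntegral_tailLimsup hmono hν.1 hA hB, setLIntegral_const]
  rcases hν.2 B hB with h | h
  · rw [h, mul_zero]
    exact measure_mono_null Set.inter_subset_right h
  · rw [h, mul_one]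
    exact measure_inter_conull ((prob_compl_eq_zero_iff hB').2 h)

variable [Finite E] [DiscreteMeasurableSpace E]

theorem IsSpecification.mem_extremeDLR_of_lintegral_sq (hγ : IsSpecification γ)
    (hmono : Monotone Λ) (hex : ∀ i, ∃ n, i ∈ Λ n) {ν : Measure (S → E)} (hν : ν ∈ dlrMeasures γ)
    (h : ∀ C ∈ spinCylinders S E, ∫⁻ ω, tailLimsup γ Λ C ω ^ 2 ∂ν = ν C ^ 2) :
    ν ∈ extremeDLR γ := by
  have := hν.1
  rw [hγ.extremeDLR_eq]
  refine ⟨hν, fun B hB => ?_⟩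
  have hB' : MeasurableSet B := tailSigma_le _ hB
  have hconst : ∀ C ∈ spinCylinders S E, ∀ᵐ ω ∂ν, tailLimsup γ Λ C ω = ν C := by
    intro C hC
    have hCm := measurableSet_of_mem_spinCylinders hC
    have h1 := hγ.setLIntegral_tailLimsup hmono hν hCm MeasurableSet.univ
    rw [Measure.restrict_univ, Set.inter_univ] at h1
    exact ae_eq_const_of_lintegral_sq_eq
      ((hγ.measurable_tailLimsup hmono hex hCm).mono tailSigma_le le_rfl)
      (hγ.tailLimsup_le_one C) h1 (h C hC)
  -- Constant conditional probabilities make each cylinder independent of `B`; hence `B` is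
  -- independent of itself and `ν B = (ν B)²`.
  have heq : ν.restrict B = ν B • ν := by
    refine measure_ext_spinCylinders (by simp) fun C hC => ?_
    have hCm := measurableSet_of_mem_spinCylinders hC
    rw [Measure.restrict_apply hCm, ← hγ.setLIntegral_tailLimsup hmono hν hCm hB,
      lintegral_congr_ae (ae_restrict_of_ae (hconst C hC)), setLIntegral_const]
    simp [mul_comm]
  have hsq : ν B = ν B * ν B := by
    have := congrArg (fun m => m B) heq
    simpa using this
  by_contra! hcon
  refine hcon.2 ?_
  have := ENNReal.mul_right_inj hcon.1 (measure_ne_top ν B) (b := 1) (c := ν B)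
  rw [mul_one] at this
  exact (this.1 hsq).symm

/-- Every condition on the right is an equation between measurable functions of `ν`, and there are
countably many. This replaces triviality on all tail events when proving measurability of
`extremeDLR γ` and when collecting null sets. -/
theorem IsSpecification.mem_extremeDLR_iff (hγ : IsSpecification γ)
    (hmono : Monotone Λ) (hex : ∀ i, ∃ n, i ∈ Λ n) {ν : Measure (S → E)} :
    ν ∈ extremeDLR γ ↔ ν Set.univ = 1 ∧
      (∀ Δ, ∀ C ∈ spinCylinders S E, ∫⁻ ω, γ Δ ω C ∂ν = ν C) ∧
      ∀ C ∈ spinCylinders S E, ∫⁻ ω, tailLimsup γ Λ C ω ^ 2 ∂ν = ν C ^ 2 := by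
  constructor
  · intro hν
    obtain ⟨hprob, hinv⟩ := hγ.mem_dlrMeasures_iff.1 hν.1
    refine ⟨measure_univ, fun Δ C hC => ?_, fun C hC => ?_⟩
    · have hCm := measurableSet_of_mem_spinCylinders hC
      rw [← Measure.bind_apply hCm (γ Δ).aemeasurable, hinv Δ]
    · have hc := hγ.ae_tailLimsup_eq_const hmono hex hν (measurableSet_of_mem_spinCylinders hC)
      have hc2 : ∀ᵐ ω ∂ν, tailLimsup γ Λ C ω ^ 2 = ν C ^ 2 := hc.mono fun ω h => by rw [h]
      rw [lintegral_congr_ae hc2]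
      simp
  · rintro ⟨h1, h2, h3⟩
    have hprob : IsProbabilityMeasure ν := ⟨h1⟩
    refine hγ.mem_extremeDLR_of_lintegral_sq hmono hex (hγ.mem_dlrMeasures_iff.2
      ⟨hprob, fun Δ => ?_⟩) h3
    have := hγ.isMarkovKernel Δ
    refine measure_ext_spinCylinders ?_ fun C hC => ?_
    · rw [Measure.bind_apply MeasurableSet.univ (γ Δ).aemeasurable]
      simp
    · rw [Measure.bind_apply (measurableSet_of_mem_spinCylinders hC) (γ Δ).aemeasurable, h2 Δ C hC]

theorem IsSpecification.measurableSet_extremeDLR (hγ : IsSpecification γ) :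
    MeasurableSet (extremeDLR γ) := by
  obtain ⟨Λ, hmono, hex⟩ := exists_exhausting S
  have e : extremeDLR γ = {ν | ν Set.univ = 1} ∩
      ((⋂ Δ, ⋂ C ∈ spinCylinders S E, {ν | ∫⁻ ω, γ Δ ω C ∂ν = ν C}) ∩
      ⋂ C ∈ spinCylinders S E, {ν | ∫⁻ ω, tailLimsup γ Λ C ω ^ 2 ∂ν = ν C ^ 2}) := by
    ext ν
    rw [hγ.mem_extremeDLR_iff hmono hex]
    simp
  rw [e]
  refine MeasurableSet.inter ?_ (MeasurableSet.inter ?_ ?_)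
  · exact measurableSet_eq_fun (Measure.measurable_coe MeasurableSet.univ) measurable_const
  · refine MeasurableSet.iInter fun Δ => MeasurableSet.biInter countable_spinCylinders
      fun C hC => ?_
    have hCm := measurableSet_of_mem_spinCylinders hC
    exact measurableSet_eq_fun (Measure.measurable_lintegral (hγ.measurable Δ hCm))
      (Measure.measurable_coe hCm)
  · refine MeasurableSet.biInter countable_spinCylinders fun C hC => ?_
    have hCm := measurableSet_of_mem_spinCylinders hC
    exact measurableSet_eq_fun (Measure.measurable_lintegral
      (((hγ.measurable_tailLimsup hmono hex hCm).mono tailSigma_le le_rfl).pow_const 2))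
      ((Measure.measurable_coe hCm).pow_const 2)

end Extreme

/-! ### Limit measures and limit events. -/

section LimitMeasure

variable {S E : Type*} [MeasurableSpace E] [DiscreteMeasurableSpace E] [Countable S] [Finite E]

/-- A sequence of probability measures on `S → E` that converges on all cylinders has a limit
which is a probability measure. -/
theorem exists_limit_measure_spinCylinders (P : ℕ → Measure (S → E))
    [∀ n, IsProbabilityMeasure (P n)]
    (h : ∀ C ∈ spinCylinders S E, ∃ c, Tendsto (fun n => P n C) atTop (𝓝 c)) :
    ∃ ν : Measure (S → E), IsProbabilityMeasure ν ∧
      ∀ C ∈ spinCylinders S E, Tendsto (fun n => P n C) atTop (𝓝 (ν C)) := by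
  -- With `E` discrete, the probability measures on `S → E` form a compact space. A limit along an
  -- ultrafilter exists there, and clopen cylinders pass to the limit.
  let : TopologicalSpace E := ⊥
  have : DiscreteTopology E := ⟨rfl⟩
  have : Countable E := Finite.to_countable
  have : BorelSpace E := ⟨by
    rw [borel_eq_top_of_discrete]
    exact eq_top_iff.2 fun _ _ => MeasurableSet.of_discrete⟩
  let Q : ℕ → ProbabilityMeasure (S → E) := fun n => ⟨P n, inferInstance⟩
  let U : Ultrafilter ℕ := Ultrafilter.of atTop
  have hU : (U : Filter ℕ) ≤ atTop := Ultrafilter.of_le atTop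
  obtain ⟨ν, -, hν⟩ := (isCompact_univ (X := ProbabilityMeasure (S → E))).ultrafilter_le_nhds
    (U.map Q) (by simp)
  refine ⟨ν, inferInstance, fun C hC => ?_⟩
  obtain ⟨c, hc⟩ := h C hC
  have hclopen : IsClopen C := by
    obtain ⟨Δ, σ, rfl⟩ := hC
    have : spinCylinder Δ σ = ⋂ i ∈ Δ, (fun ω : S → E => ω i) ⁻¹' {σ i} := by
      ext ω; simp [spinCylinder]
    rw [this]
    exact Δ.finite_toSet.isClopen_biInter fun i _ =>
      (isClopen_discrete _).preimage (continuous_apply i)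
  have ht : Tendsto Q U (𝓝 ν) := hν
  have ht' := ProbabilityMeasure.tendsto_measure_of_null_frontier_of_tendsto' ht (E := C)
    (by rw [hclopen.frontier_eq]; exact measure_empty)
  rwa [tendsto_nhds_unique ht' (hc.mono_left hU)]

variable {γ : Finset S → Kernel (S → E) (S → E)} {Λ : ℕ → Finset S}

/-- On the measurable set `D` of convergence on cylinders, the limit measure `p` depends measurably
on `ω`; the event is the preimage of `M` under `p`, where `M` is measurable among all measures
because `extremeDLR γ` is. -/
theorem IsSpecification.measurableSet_limitEvent (hγ : IsSpecification γ)
    {M : Set (extremeDLR γ)} (hM : MeasurableSet M) : MeasurableSet (limitEvent γ Λ M) := by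
  have := fun Δ => hγ.isMarkovKernel Δ
  let D : Set (S → E) := {ω | ∀ C ∈ spinCylinders S E,
    ∃ c, Tendsto (fun n => γ (Λ n) ω C) atTop (𝓝 c)}
  have hD : MeasurableSet D := by
    have e : D = ⋂ C ∈ spinCylinders S E,
        {ω | ∃ c, Tendsto (fun n => γ (Λ n) ω C) atTop (𝓝 c)} := by
      ext ω; simp [D]
    rw [e]
    exact MeasurableSet.biInter countable_spinCylinders fun C hC =>
      measurableSet_exists_tendsto fun n =>
        hγ.measurable (Λ n) (measurableSet_of_mem_spinCylinders hC)
  choose p hp hlim using fun ω : D =>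
    exists_limit_measure_spinCylinders (fun n => γ (Λ n) ω) ω.2
  have hpm : Measurable p := by
    refine Measurable.measure_of_isPiSystem_of_isProbabilityMeasure generateFrom_spinCylinders
      isPiSystem_spinCylinders fun C hC => ?_
    have e : (fun ω => p ω C) = fun ω : D => limsup (fun n => γ (Λ n) ω C) atTop :=
      funext fun ω => (hlim ω C hC).limsup_eq.symm
    rw [e]
    exact Measurable.limsup fun n =>
      (hγ.measurable (Λ n) (measurableSet_of_mem_spinCylinders hC)).comp measurable_subtype_coe
  have hM' : MeasurableSet (Subtype.val '' M) := hγ.measurableSet_extremeDLR.subtype_image hM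
  have e : limitEvent γ Λ M = Subtype.val '' (p ⁻¹' (Subtype.val '' M)) := by
    ext ω
    constructor
    · rintro ⟨ν, hν, h⟩
      have hω : ω ∈ D := by
        rintro _ ⟨Δ, σ, rfl⟩
        exact ⟨_, h Δ σ⟩
      refine ⟨⟨ω, hω⟩, ⟨ν, hν, ?_⟩, rfl⟩
      have := ν.2.1.1
      refine measure_ext_spinCylinders (by simp) ?_
      rintro _ ⟨Δ, σ, rfl⟩
      exact tendsto_nhds_unique (h Δ σ) (hlim ⟨ω, hω⟩ _ ⟨Δ, σ, rfl⟩)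
    · rintro ⟨ω, ⟨ν, hν, h⟩, rfl⟩
      refine ⟨ν, hν, fun Δ σ => ?_⟩
      rw [h]
      exact hlim ω _ ⟨Δ, σ, rfl⟩
  rw [e]
  exact hD.subtype_image (hpm hM')

theorem IsSpecification.measure_limitEvent_of_extreme (hγ : IsSpecification γ)
    (hmono : Monotone Λ) (hex : ∀ i, ∃ n, i ∈ Λ n) {M : Set (extremeDLR γ)} (ν : extremeDLR γ) :
    (ν : Measure (S → E)) (limitEvent γ Λ M) = M.indicator 1 ν := by
  have := ν.2.1.1
  have hconv : ∀ᵐ ω ∂(ν : Measure (S → E)), ∀ C ∈ spinCylinders S E,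
      Tendsto (fun n => γ (Λ n) ω C) atTop (𝓝 ((ν : Measure (S → E)) C)) := by
    rw [ae_ball_iff countable_spinCylinders]
    intro C hC
    have hCm := measurableSet_of_mem_spinCylinders hC
    filter_upwards [hγ.ae_tendsto_tailLimsup hmono ν.2.1 hCm,
      hγ.ae_tailLimsup_eq_const hmono hex ν.2 hCm] with ω h1 h2
    rwa [h2] at h1
  by_cases hν : ν ∈ M
  · rw [Set.indicator_of_mem hν, Pi.one_apply, ← measure_univ (μ := (ν : Measure (S → E)))]
    refine measure_congr (eventuallyEq_univ.2 ?_)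
    filter_upwards [hconv] with ω hω
    exact ⟨ν, hν, fun Δ σ => hω _ ⟨Δ, σ, rfl⟩⟩
  · rw [Set.indicator_of_notMem hν, measure_eq_zero_iff_ae_notMem]
    filter_upwards [hconv] with ω hω
    rintro ⟨ν', hν', h⟩
    have heq : ν = ν' := by
      refine Subtype.ext (measure_ext_spinCylinders ?_ ?_)
      · have := ν'.2.1.1
        simp
      · rintro _ ⟨Δ, σ, rfl⟩
        exact tendsto_nhds_unique (hω _ ⟨Δ, σ, rfl⟩) (h Δ σ)
    exact hν (heq ▸ hν')

/-- Any measure representing `μ` on the extreme DLR measures is given by the limit events. -/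
theorem IsSpecification.representing_apply (hγ : IsSpecification γ)
    (hmono : Monotone Λ) (hex : ∀ i, ∃ n, i ∈ Λ n) {μ : Measure (S → E)}
    {α : Measure (extremeDLR γ)}
    (hα : ∀ A, MeasurableSet A → μ A = ∫⁻ ν, (ν : Measure (S → E)) A ∂α)
    {M : Set (extremeDLR γ)} (hM : MeasurableSet M) : α M = μ (limitEvent γ Λ M) := by
  rw [hα _ (hγ.measurableSet_limitEvent hM)]
  simp_rw [hγ.measure_limitEvent_of_extreme hmono hex]
  rw [lintegral_indicator_one hM]

end LimitMeasure

/-! ### Disintegration over the tail and existence of the representation. -/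

theorem setLIntegral_lintegral_condExpKernel {Ω : Type*} {m : MeasurableSpace Ω}
    [mΩ : MeasurableSpace Ω] [StandardBorelSpace Ω] {μ : Measure Ω} [IsFiniteMeasure μ]
    (hm : m ≤ mΩ) {f : Ω → ℝ≥0∞} (hf : Measurable f) {B : Set Ω} (hB : MeasurableSet[m] B) :
    ∫⁻ ω in B, ∫⁻ x, f x ∂(condExpKernel μ m ω) ∂μ = ∫⁻ ω in B, f ω ∂μ := by
  have hF : Measurable[m] fun ω => ∫⁻ x, f x ∂(condExpKernel μ m ω) := hf.lintegral_kernel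
  -- The kernel composed with `μ` on `m` is the law of `ω ↦ (ω, ω)`, with `m` on the first factor
  -- only.
  have hd : @Measurable Ω (Ω × Ω) mΩ (m.prod mΩ) Function.diag :=
    (measurable_id.mono le_rfl hm).prodMk measurable_id
  have hf2 : @Measurable (Ω × Ω) ℝ≥0∞ (m.prod mΩ) _ fun p => f p.2 := hf.comp measurable_snd
  have hBs : @MeasurableSet (Ω × Ω) (m.prod mΩ) (B ×ˢ Set.univ) := hB.prod MeasurableSet.univ
  have h := Measure.setLIntegral_compProd (μ := μ.trim hm) (κ := condExpKernel μ m) hf2 hB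
    MeasurableSet.univ
  simp only [Measure.restrict_univ] at h
  have h2 := @setLIntegral_map _ _ mΩ (m.prod mΩ) μ _ _ _ hBs hf2 hd
  rw [compProd_trim_condExpKernel hm, h2] at h
  rw [← lintegral_trim hm hF, ← restrict_trim hm μ hB, ← h]
  congr 2
  ext ω
  simp

section Decomposition

variable {S E : Type*} [MeasurableSpace E] [DiscreteMeasurableSpace E] [Countable S] [Finite E]
  {γ : Finset S → Kernel (S → E) (S → E)}

/-- Conditioning a DLR measure on the tail σ-algebra gives extreme DLR measures. -/
theorem IsSpecification.ae_condExpKernel_mem_extremeDLR [StandardBorelSpace (S → E)]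
    (hγ : IsSpecification γ) {μ : Measure (S → E)} [IsProbabilityMeasure μ]
    (hμ : μ ∈ dlrMeasures γ) :
    ∀ᵐ ω ∂μ, condExpKernel μ (tailSigma S E) ω ∈ extremeDLR γ := by
  obtain ⟨Λ, hmono, hex⟩ := exists_exhausting S
  have hinv := (hγ.mem_dlrMeasures_iff.1 hμ).2
  have hκm : ∀ A, MeasurableSet A →
      Measurable[tailSigma S E] fun ω => condExpKernel μ (tailSigma S E) ω A :=
    fun A hA => measurable_condExpKernel hA
  have hκ : ∀ A B, MeasurableSet A → MeasurableSet[tailSigma S E] B →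
      ∫⁻ ω in B, condExpKernel μ (tailSigma S E) ω A ∂μ = μ (A ∩ B) := by
    intro A B hA hB
    have h := setLIntegral_lintegral_condExpKernel (μ := μ) tailSigma_le
      (f := A.indicator 1) (measurable_one.indicator hA) hB
    simp_rw [lintegral_indicator_one hA] at h
    rw [h, Measure.restrict_apply hA]
  have h1 : ∀ᵐ ω ∂μ, ∀ Δ, ∀ C ∈ spinCylinders S E,
      ∫⁻ x, γ Δ x C ∂(condExpKernel μ (tailSigma S E) ω) =
        condExpKernel μ (tailSigma S E) ω C := by
    rw [ae_all_iff]
    intro Δ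
    rw [ae_ball_iff countable_spinCylinders]
    intro C hC
    have hCm := measurableSet_of_mem_spinCylinders hC
    refine ae_eq_of_forall_setLIntegral_eq_of_le tailSigma_le
      (hγ.measurable Δ hCm).lintegral_kernel (hκm C hCm) fun B hB => ?_
    rw [setLIntegral_lintegral_condExpKernel tailSigma_le (hγ.measurable Δ hCm) hB,
      hγ.setLIntegral_apply (hinv Δ) hCm (iInf_le outsideSigma Δ B hB), hκ C B hCm hB]
  have h2 : ∀ᵐ ω ∂μ, ∀ C ∈ spinCylinders S E,
      ∫⁻ x, tailLimsup γ Λ C x ^ 2 ∂(condExpKernel μ (tailSigma S E) ω) =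
        condExpKernel μ (tailSigma S E) ω C ^ 2 := by
    rw [ae_ball_iff countable_spinCylinders]
    intro C hC
    have hCm := measurableSet_of_mem_spinCylinders hC
    have hg := hγ.measurable_tailLimsup hmono hex hCm
    have hg2 : Measurable[tailSigma S E] fun ω => tailLimsup γ Λ C ω ^ 2 := hg.pow_const 2
    have hg2' := hg2.mono tailSigma_le le_rfl
    -- A tail-measurable function is almost surely reproduced by the tail conditional kernel. With
    -- `e2`, this gives the second-moment criterion for extremality.
    have e1 : ∀ᵐ ω ∂μ, ∫⁻ x, tailLimsup γ Λ C x ^ 2 ∂(condExpKernel μ (tailSigma S E) ω) =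
        tailLimsup γ Λ C ω ^ 2 :=
      ae_eq_of_forall_setLIntegral_eq_of_le tailSigma_le hg2'.lintegral_kernel hg2 fun B hB =>
        setLIntegral_lintegral_condExpKernel tailSigma_le hg2' hB
    have e2 : ∀ᵐ ω ∂μ, tailLimsup γ Λ C ω = condExpKernel μ (tailSigma S E) ω C :=
      ae_eq_of_forall_setLIntegral_eq_of_le tailSigma_le hg (hκm C hCm) fun B hB => by
        rw [hγ.setLIntegral_tailLimsup hmono hμ hCm hB, hκ C B hCm hB]
    filter_upwards [e1, e2] with ω h h'
    rw [h, h']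
  filter_upwards [h1, h2] with ω h h'
  exact (hγ.mem_extremeDLR_iff hmono hex).2 ⟨measure_univ, h, h'⟩

theorem IsSpecification.exists_representing (hγ : IsSpecification γ) {μ : Measure (S → E)}
    (hμ : μ ∈ dlrMeasures γ) : ∃ α : Measure (extremeDLR γ), IsProbabilityMeasure α ∧
      ∀ A, MeasurableSet A → μ A = ∫⁻ ν, (ν : Measure (S → E)) A ∂α := by
  have : Countable E := Finite.to_countable
  have := hμ.1
  have hκ : Measurable fun ω => condExpKernel μ (tailSigma S E) ω :=
    (condExpKernel μ (tailSigma S E)).measurable.mono tailSigma_le le_rfl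
  -- Measurability of the extreme set lets the law of the conditional measure, which is concentrated
  -- there, be pulled back to the subtype without losing mass.
  have hexm := hγ.measurableSet_extremeDLR
  have hae : ∀ᵐ ν ∂(μ.map fun ω => condExpKernel μ (tailSigma S E) ω), ν ∈ extremeDLR γ :=
    (ae_map_iff hκ.aemeasurable hexm).2 (hγ.ae_condExpKernel_mem_extremeDLR hμ)
  have hrep : ∀ f : Measure (S → E) → ℝ≥0∞, Measurable f →
      ∫⁻ ν : extremeDLR γ, f ν ∂((μ.map fun ω => condExpKernel μ (tailSigma S E) ω).comap
        Subtype.val) = ∫⁻ ω, f (condExpKernel μ (tailSigma S E) ω) ∂μ := by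
    intro f hf
    rw [lintegral_subtype_comap hexm, Measure.restrict_eq_self_of_ae_mem hae,
      lintegral_map hf hκ]
  refine ⟨(μ.map fun ω => condExpKernel μ (tailSigma S E) ω).comap Subtype.val, ⟨?_⟩,
    fun A hA => ?_⟩
  · simpa using hrep (fun _ => 1) measurable_const
  · rw [hrep _ (Measure.measurable_coe hA)]
    have h := setLIntegral_lintegral_condExpKernel (μ := μ) (tailSigma_le (S := S) (E := E))
      (f := A.indicator 1) (measurable_one.indicator hA) MeasurableSet.univ
    simp_rw [lintegral_indicator_one hA, Measure.restrict_univ] at h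
    exact h.symm

end Decomposition

/-! ### The extreme decomposition. -/

theorem mainTheorem1 {S E : Type*} [Countable S] [Finite E] [MeasurableSpace E]
    [DiscreteMeasurableSpace E] (γ : Finset S → Kernel (S → E) (S → E))
    (hγ : IsSpecification γ) (hne : (dlrMeasures γ).Nonempty) :
    Convex ℝ≥0 (dlrMeasures γ) ∧
    extremeDLR γ =
      {μ ∈ dlrMeasures γ | ∀ B, MeasurableSet[tailSigma S E] B → μ B = 0 ∨ μ B = 1} ∧
    (∀ μ ∈ extremeDLR γ, ∀ ν ∈ extremeDLR γ, μ ≠ ν →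
      μ ⟂ₘ ν ∧ ∃ B, MeasurableSet[tailSigma S E] B ∧ μ B = 1 ∧ ν B = 0) ∧
    (∀ μ ∈ dlrMeasures γ, ∀ ν ∈ dlrMeasures γ,
      (∀ B, MeasurableSet[tailSigma S E] B → μ B = ν B) → μ = ν) ∧
    (∀ μ ∈ dlrMeasures γ, ∃ α : Measure (extremeDLR γ),
      (IsProbabilityMeasure α ∧
        ∀ A, MeasurableSet A → μ A = ∫⁻ ν, (ν : Measure (S → E)) A ∂α) ∧
      (∀ α' : Measure (extremeDLR γ), IsProbabilityMeasure α' →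
        (∀ A, MeasurableSet A → μ A = ∫⁻ ν, (ν : Measure (S → E)) A ∂α') → α' = α) ∧
      (∀ Λ : ℕ → Finset S, Monotone Λ → (∀ i, ∃ n, i ∈ Λ n) →
        ∀ M : Set (extremeDLR γ), MeasurableSet M →
          MeasurableSet (limitEvent γ Λ M) ∧ α M = μ (limitEvent γ Λ M))) := by
  refine ⟨hγ.convex_dlrMeasures, hγ.extremeDLR_eq, fun μ hμ ν hν hμν => ?_,
    fun μ hμ ν hν h => hγ.eq_of_tailSigma hμ hν h, fun μ hμ => ?_⟩
  · obtain ⟨B, hB, h1, h0⟩ := hγ.exists_tail_separating hμ hν hμν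
    have := hμ.1.1
    have hB' : MeasurableSet B := tailSigma_le _ hB
    refine ⟨⟨Bᶜ, hB'.compl, (prob_compl_eq_zero_iff hB').2 h1, ?_⟩, B, hB, h1, h0⟩
    rwa [compl_compl]
  · obtain ⟨α, hα, hrep⟩ := hγ.exists_representing hμ
    refine ⟨α, ⟨hα, hrep⟩, fun α' _ hrep' => ?_, fun Λ hmono hex M hM =>
      ⟨hγ.measurableSet_limitEvent hM, hγ.representing_apply hmono hex hrep hM⟩⟩
    -- Any one exhausting sequence suffices for uniqueness: the limit events do not involve the
    -- representing measure.
    obtain ⟨Λ, hmono, hex⟩ := exists_exhausting S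
    ext M hM
    rw [hγ.representing_apply hmono hex hrep hM, hγ.representing_apply hmono hex hrep' hM]
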